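/- Let $\mathsf{Grp}(\mathsf{HComp})$ be the category of compact Hausdorff topological groups and continuous homomorphisms, let $\mathsf{Ab}(\mathsf{HComp})$ be its full subcategory of abelian groups, and let $\mathsf{Ab}(\mathsf{Prof})$ be the full subcategory of abelian profinite (i.e. abelian and totally disconnected) groups. Write $\overline{X}$ for topological closure and $G_0$ for the connected component of the neutral element of $G$. Let $I\colon \mathsf{Grp}(\mathsf{HComp})\to\mathsf{Ab}(\mathsf{Prof})$ be the composite of the reflectors $G\mapsto G/\overline{[G,G]}$ onto $\mathsf{Ab}(\mathsf{HComp})$ and $A\mapsto A/A_0$ onto $\mathsf{Ab}(\mathsf{Prof})$; it is left adjoint to the inclusion, with unit $\eta$. An extension of $B$ is a regular epimorphism $p\colon E\to B$ in $\mathsf{Grp}(\mathsf{HComp})$. It is trivial if its naturality square for $\eta$ is a pullback. It is normal if pulling back along $p$ is a monadic functor from extensions of $B$ to extensions of $E$, and the first projection $\pi_1\colon E\times_B E\to E$ is a trivial extension. It is a weakly universal normal extension if it is normal and, for every normal extension $p'\colon E'\to B$, there is a morphism $u\colon E\to E'$ with $p'u=p$. The Galois group $\mathsf{Gal}(E,p,0)$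 of a normal extension $p$ is the pullback in $\mathsf{Ab}(\mathsf{Prof})$ of $0\to I(E)\times I(E)$ along $\langle I(\pi_1),I(\pi_2)\rangle\colon I(E\times_B E)\to I(E)\times I(E)$, and the fundamental group $\pi_1(B)$ is the Galois group of any weakly universal normal extension of $B$. Let $f\colon P\to B$ be a regular epimorphism of compact Hausdorff groups with kernel $K$, where $P$ is projective with respect to regular epimorphisms. Then $B$ has a weakly universal normal extension, and for every weakly universal normal extension $p\colon E\to B$ there is an isomorphism of topological groups $$\pi_1(B)=\mathsf{Gal}(E,p,0)\;\cong\;\frac{K\cap\bigl(\overline{[P,P]}\cdot P_0\bigr)}{\overline{[K,P]}\cdot K_0}.$$ -/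

import Mathlib

open CategoryTheory CategoryTheory.Limits

universe u v₁ v₂ u₁ u₂

/-! ### Galois structures, normal extensions, Galois groups -/

/-- A Galois structure: a full reflective subcategory `H : ℬ ⥤ 𝒜` with reflector `I`, together with
a class `E` of morphisms of `𝒜` (the extensions) that contains the isomorphisms, is closed under
composition, is pullback stable, and is preserved by `H ∘ I`.  Pullbacks along members of `E`
exist since `𝒜` is assumed to have pullbacks. -/
structure GaloisStructure (𝒜 : Type u₁) [Category.{v₁} 𝒜] [HasPullbacks 𝒜]
    (ℬ : Type u₂) [Category.{v₂} ℬ] where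
  /-- the reflector -/
  I : 𝒜 ⥤ ℬ
  /-- the inclusion -/
  H : ℬ ⥤ 𝒜
  /-- the adjunction -/
  adj : I ⊣ H
  full : H.Full
  faithful : H.Faithful
  /-- the class of extensions -/
  E : MorphismProperty 𝒜
  map_mem : ∀ {X Y : 𝒜} (f : X ⟶ Y), E f → E (H.map (I.map f))
  isMultiplicative : E.IsMultiplicative
  isStableUnderBaseChange : E.IsStableUnderBaseChange

namespace GaloisStructure

variable {𝒜 : Type u₁} [Category.{v₁} 𝒜] [HasPullbacks 𝒜] {ℬ : Type u₂} [Category.{v₂} ℬ]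
  (Γ : GaloisStructure 𝒜 ℬ)

instance : Γ.E.IsMultiplicative := Γ.isMultiplicative

instance : Γ.E.IsStableUnderBaseChange := Γ.isStableUnderBaseChange

/-- The pullback functor `p^* : 𝒜 ↓ B ⥤ 𝒜 ↓ X`, where `𝒜 ↓ B` is the full subcategory of the slice
category over `B` whose objects are the extensions of `B`. -/
noncomputable def pullbackFunctor {X B : 𝒜} (p : X ⟶ B) : Γ.E.Over ⊤ B ⥤ Γ.E.Over ⊤ X :=
  MorphismProperty.Over.pullback Γ.E ⊤ p

/-- Monadic extensions: members of `E` whose pullback functor is monadic. -/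
def IsMonadicExtension {X B : 𝒜} (p : X ⟶ B) : Prop :=
  Γ.E p ∧ Nonempty (MonadicRightAdjoint (Γ.pullbackFunctor p))

/-- Trivial extensions: the naturality square of the unit at `f` is a pullback. -/
def IsTrivialExtension {X B : 𝒜} (f : X ⟶ B) : Prop :=
  Γ.E f ∧ IsPullback (Γ.adj.unit.app X) f (Γ.H.map (Γ.I.map f)) (Γ.adj.unit.app B)

/-- Normal extensions: monadic extensions `p` such that `p^*(p)`, the first projection of the
kernel pair of `p`, is a trivial extension. -/
def IsNormalExtension {X B : 𝒜} (p : X ⟶ B) : Prop :=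
  Γ.IsMonadicExtension p ∧ Γ.IsTrivialExtension (pullback.fst p p)

/-- Weakly universal normal extensions of `B`. -/
def IsWeaklyUniversalNormalExtension {X B : 𝒜} (p : X ⟶ B) : Prop :=
  Γ.IsNormalExtension p ∧
    ∀ ⦃X' : 𝒜⦄ (p' : X' ⟶ B), Γ.IsNormalExtension p' → ∃ u : X ⟶ X', u ≫ p' = p

/-- The Galois group `Gal(X, p, 0)`: the pullback of `0 ⟶ I(X) × I(X)` along
`⟨I(π₁), I(π₂)⟩ : I(X ×_B X) ⟶ I(X) × I(X)`. -/
noncomputable def galoisGroup [HasFiniteLimits ℬ] [HasZeroMorphisms ℬ] [HasZeroObject ℬ]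
    {X B : 𝒜} (p : X ⟶ B) : ℬ :=
  open scoped ZeroObject in
  pullback (prod.lift (Γ.I.map (pullback.fst p p)) (Γ.I.map (pullback.snd p p)))
    (0 : (0 : ℬ) ⟶ Γ.I.obj X ⨯ Γ.I.obj X)

end GaloisStructure

/-- `P` is projective with respect to the class `E` of morphisms. -/
def IsProjectiveWrt {𝒜 : Type u₁} [Category.{v₁} 𝒜] (E : MorphismProperty 𝒜) (P : 𝒜) : Prop :=
  ∀ ⦃X Y : 𝒜⦄ (e : X ⟶ Y) (g : P ⟶ Y), E e → ∃ l : P ⟶ X, l ≫ e = g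

/-! ### The category of compact Hausdorff groups -/

/-- Compact Hausdorff topological groups. -/
structure CompGrp : Type (u + 1) where
  /-- the underlying type -/
  carrier : Type u
  [group : Group carrier]
  [top : TopologicalSpace carrier]
  [isTopologicalGroup : IsTopologicalGroup carrier]
  [compact : CompactSpace carrier]
  [hausdorff : T2Space carrier]

namespace CompGrp

instance : CoeSort CompGrp.{u} (Type u) := ⟨CompGrp.carrier⟩

attribute [instance] group top isTopologicalGroup compact hausdorff

/-- Bundle a compact Hausdorff group. -/
abbrev of (G : Type u) [Group G] [TopologicalSpace G] [IsTopologicalGroup G] [CompactSpace G]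
    [T2Space G] : CompGrp.{u} := ⟨G⟩

/-- Morphisms are the continuous homomorphisms. -/
@[ext]
structure Hom (G H : CompGrp.{u}) : Type u where
  /-- the underlying continuous homomorphism -/
  hom' : G →ₜ* H

instance : Category.{u} CompGrp.{u} where
  Hom G H := Hom G H
  id G := ⟨ContinuousMonoidHom.id G⟩
  comp f g := ⟨g.hom'.comp f.hom'⟩

instance : ConcreteCategory CompGrp.{u} (fun G H => G →ₜ* H) where
  hom f := f.hom'
  ofHom f := ⟨f⟩

/-- The continuous homomorphism underlying a morphism. -/
abbrev Hom.hom {G H : CompGrp.{u}} (f : Hom G H) : G →ₜ* H :=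
  ConcreteCategory.hom (C := CompGrp) f

/-- A continuous homomorphism as a morphism. -/
abbrev ofHom {G H : CompGrp.{u}} (f : G →ₜ* H) : G ⟶ H := ConcreteCategory.ofHom (C := CompGrp) f

@[ext]
lemma hom_ext {G H : CompGrp.{u}} {f g : G ⟶ H} (h : ∀ x, f.hom x = g.hom x) : f = g :=
  Hom.ext (ContinuousMonoidHom.ext h)

@[simp]
lemma id_apply {G : CompGrp.{u}} (x : G) : Hom.hom (𝟙 G) x = x := rfl

@[simp]
lemma comp_apply {G H K : CompGrp.{u}} (f : G ⟶ H) (g : H ⟶ K) (x : G) :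
    (f ≫ g).hom x = g.hom (f.hom x) := rfl

@[simp]
lemma ofHom_apply {G H : CompGrp.{u}} (f : G →ₜ* H) (x : G) : (ofHom f).hom x = f x := rfl

/-- A closed subgroup, as an object. -/
def ofClosed {G : CompGrp.{u}} (S : Subgroup G) (hS : IsClosed (S : Set G)) : CompGrp.{u} :=
  have : CompactSpace S := isCompact_iff_compactSpace.mp hS.isCompact
  of S

/-- The quotient by a closed normal subgroup, as an object. -/
def quot {G : CompGrp.{u}} (N : Subgroup G) [N.Normal] (hN : IsClosed (N : Set G)) :
    CompGrp.{u} :=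
  have := hN
  of (G ⧸ N)

/-- The projection onto the quotient by a closed normal subgroup. -/
def quotMk {G : CompGrp.{u}} (N : Subgroup G) [N.Normal] (hN : IsClosed (N : Set G)) :
    G ⟶ quot N hN :=
  ofHom (H := quot N hN) ⟨QuotientGroup.mk' N, QuotientGroup.continuous_mk⟩

/-- The universal property of the quotient. -/
def quotLift {G H : CompGrp.{u}} (N : Subgroup G) [N.Normal] (hN : IsClosed (N : Set G))
    (f : G ⟶ H) (hf : ∀ x ∈ N, f.hom x = 1) : quot N hN ⟶ H :=
  ofHom (G := quot N hN) ⟨QuotientGroup.lift N f.hom.toMonoidHom hf,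
    Continuous.quotient_lift f.hom.continuous_toFun _⟩

lemma quotMk_surjective {G : CompGrp.{u}} (N : Subgroup G) [N.Normal]
    (hN : IsClosed (N : Set G)) : Function.Surjective (quotMk N hN).hom :=
  QuotientGroup.mk'_surjective N

@[simp]
lemma quotLift_mk {G H : CompGrp.{u}} (N : Subgroup G) [N.Normal] (hN : IsClosed (N : Set G))
    (f : G ⟶ H) (hf : ∀ x ∈ N, f.hom x = 1) (x : G) :
    (quotLift N hN f hf).hom ((quotMk N hN).hom x) = f.hom x := rfl

lemma quotMk_eq_one {G : CompGrp.{u}} (N : Subgroup G) [N.Normal]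
    (hN : IsClosed (N : Set G)) {x : G} (hx : x ∈ N) : (quotMk N hN).hom x = 1 :=
  (QuotientGroup.eq_one_iff x).mpr hx

instance : HasZeroMorphisms CompGrp.{u} where
  zero G H := ⟨ofHom 1⟩
  comp_zero _ _ := rfl
  zero_comp _ _ _ f := by
    ext x
    exact map_one f.hom

lemma isZero_punit : IsZero (of PUnit.{u + 1}) where
  unique_to G := ⟨⟨⟨ofHom 1⟩, fun f => by
    ext x
    exact map_one f.hom⟩⟩
  unique_from G := ⟨⟨⟨ofHom 1⟩, fun f => rfl⟩⟩

instance : HasZeroObject CompGrp.{u} := ⟨⟨_, isZero_punit⟩⟩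

section Pullback

variable {X Y Z : CompGrp.{u}} (f : X ⟶ Z) (g : Y ⟶ Z)

/-- The explicit fibre product. -/
def fibre : CompGrp.{u} :=
  ofClosed (G := of (X × Y))
    (MonoidHom.eqLocus (f.hom.toMonoidHom.comp (MonoidHom.fst X Y))
      (g.hom.toMonoidHom.comp (MonoidHom.snd X Y)))
    (isClosed_eq (f.hom.continuous_toFun.comp continuous_fst)
      (g.hom.continuous_toFun.comp continuous_snd))

/-- First projection. -/
def fibreFst : fibre f g ⟶ X :=
  ofHom (G := fibre f g) ⟨(MonoidHom.fst X Y).comp (Subgroup.subtype _),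
    continuous_fst.comp continuous_subtype_val⟩

/-- Second projection. -/
def fibreSnd : fibre f g ⟶ Y :=
  ofHom (G := fibre f g) ⟨(MonoidHom.snd X Y).comp (Subgroup.subtype _),
    continuous_snd.comp continuous_subtype_val⟩

lemma isPullback_fibre : IsPullback (fibreFst f g) (fibreSnd f g) f g where
  w := by
    ext x
    exact x.2
  isLimit' := ⟨PullbackCone.IsLimit.mk _
    (fun s => ofHom (H := fibre f g)
      ⟨(s.fst.hom.toMonoidHom.prod s.snd.hom.toMonoidHom).codRestrict _
        (fun x => congrArg (fun k : s.pt ⟶ Z => k.hom x) s.condition),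
        (s.fst.hom.continuous_toFun.prodMk s.snd.hom.continuous_toFun).subtype_mk _⟩)
    (fun s => rfl) (fun s => rfl)
    (fun s m h₁ h₂ => by
      ext x
      exact Subtype.ext (Prod.ext (congrArg (fun k : s.pt ⟶ X => k.hom x) h₁)
        (congrArg (fun k : s.pt ⟶ Y => k.hom x) h₂)))⟩

end Pullback

instance : HasPullbacks CompGrp.{u} :=
  have : ∀ {X Y Z : CompGrp.{u}} {f : X ⟶ Z} {g : Y ⟶ Z}, HasLimit (cospan f g) :=
    fun {_ _ _ f g} => (isPullback_fibre f g).hasPullback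
  hasPullbacks_of_hasLimit_cospan _

instance : HasFiniteLimits CompGrp.{u} := hasFiniteLimits_of_hasTerminal_and_pullbacks

lemma surjective_of_isIso {X Y : CompGrp.{u}} (f : X ⟶ Y) [IsIso f] :
    Function.Surjective f.hom := fun y =>
  ⟨(inv f).hom y, congrArg (fun k : Y ⟶ Y => k.hom y) (IsIso.inv_hom_id f)⟩

/-- Regular epimorphisms of compact groups are exactly the surjective morphisms. -/
lemma isRegularEpi_iff_surjective {X Y : CompGrp.{u}} (f : X ⟶ Y) :
    IsRegularEpi f ↔ Function.Surjective f.hom := by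
  constructor
  · intro hf
    have hcl : IsClosed ((f.hom.toMonoidHom.range : Subgroup Y) : Set Y) :=
      (isCompact_range f.hom.continuous_toFun).isClosed
    let e : X ⟶ ofClosed _ hcl := ofHom (H := ofClosed _ hcl)
      ⟨f.hom.toMonoidHom.rangeRestrict, f.hom.continuous_toFun.subtype_mk _⟩
    let m : ofClosed _ hcl ⟶ Y := ofHom (G := ofClosed _ hcl)
      ⟨Subgroup.subtype _, continuous_subtype_val⟩
    have hm : Mono m := ⟨fun a b h => by
      ext x
      exact Subtype.ext (congrArg (fun k => Hom.hom k x) h)⟩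
    have hem : e ≫ m = f := rfl
    have : IsIso m := ExtremalEpi.isIso f e m hem
    intro y
    obtain ⟨⟨_, x, rfl⟩, hy⟩ := surjective_of_isIso m y
    exact ⟨x, hy⟩
  · intro hf
    have hq : Topology.IsQuotientMap f.hom :=
      f.hom.continuous_toFun.isClosedMap.isQuotientMap f.hom.continuous_toFun hf
    refine ⟨⟨⟨fibre f f, fibreFst f f, fibreSnd f f, (isPullback_fibre f f).w, ?_⟩⟩⟩
    have key : ∀ {Z : CompGrp.{u}} (k : X ⟶ Z) (_ : fibreFst f f ≫ k = fibreSnd f f ≫ k)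
        (a b : X), f.hom a = f.hom b → k.hom a = k.hom b := fun k hk a b hab =>
      congrArg (fun l : fibre f f ⟶ _ => l.hom ⟨(a, b), hab⟩) hk
    refine Cofork.IsColimit.mk' _ fun s => ?_
    have hs := fun a b => key s.π s.condition a b
    have hinv : ∀ y, f.hom (Function.surjInv hf y) = y := Function.surjInv_eq hf
    refine ⟨ofHom ⟨MonoidHom.mk' (fun y => s.π.hom (Function.surjInv hf y)) ?_, ?_⟩, ?_, ?_⟩
    · intro a b
      rw [← map_mul]
      exact hs _ _ (by rw [map_mul, hinv, hinv, hinv])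
    · refine hq.continuous_iff.mpr (s.π.hom.continuous_toFun.congr fun x => ?_)
      exact hs _ _ (hinv _).symm
    · ext x
      exact hs _ _ (hinv _)
    · intro m hm
      ext y
      obtain ⟨x, rfl⟩ := hf y
      exact (congrArg (fun l : X ⟶ s.pt => l.hom x) hm).trans (hs _ _ (hinv _).symm)

instance : (MorphismProperty.regularEpi CompGrp.{u}).IsMultiplicative where
  id_mem _ := (isRegularEpi_iff_surjective _).mpr Function.surjective_id
  comp_mem f g hf hg := (isRegularEpi_iff_surjective _).mpr
    (((isRegularEpi_iff_surjective g).mp hg).comp ((isRegularEpi_iff_surjective f).mp hf))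

instance : (MorphismProperty.regularEpi CompGrp.{u}).IsStableUnderBaseChange where
  of_isPullback {X Y Y' S f g f' g'} sq hg := by
    rw [MorphismProperty.regularEpi_iff, isRegularEpi_iff_surjective] at hg ⊢
    intro y
    obtain ⟨x, hx⟩ := hg (f.hom y)
    let t := sq.lift (fibreFst g f) (fibreSnd g f) (isPullback_fibre g f).w
    exact ⟨t.hom ⟨(x, y), hx⟩, congrArg (fun l : fibre g f ⟶ _ => l.hom ⟨(x, y), hx⟩)
      (sq.lift_snd _ _ _)⟩

/-! ### Abelian compact groups and abelian profinite groups -/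

/-- Commutativity, as a property of compact groups. -/
def isAbelian : ObjectProperty CompGrp.{u} := fun G => ∀ x y : G, x * y = y * x

/-- `Ab(HComp)`: the full subcategory of abelian compact groups. -/
abbrev AbComp : Type (u + 1) := (isAbelian.{u}).FullSubcategory

/-- Total disconnectedness, as a property of abelian compact groups. -/
def isProfinite : ObjectProperty AbComp.{u} := fun G => TotallyDisconnectedSpace G.obj

/-- `Ab(Prof)`: the full subcategory of abelian profinite groups. -/
abbrev AbProf : Type (u + 1) := (isProfinite.{u}).FullSubcategory

/-- The closure of the derived subgroup. -/
def closedDerived (G : CompGrp.{u}) : Subgroup G := (commutator G).topologicalClosure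

lemma isClosed_closedDerived (G : CompGrp.{u}) : IsClosed (closedDerived G : Set G) :=
  Subgroup.isClosed_topologicalClosure _

instance (G : CompGrp.{u}) : (closedDerived G).Normal :=
  Subgroup.is_normal_topologicalClosure _

open scoped commutatorElement in
/-- The abelianization `G / cl[G, G]`. -/
def abObj (G : CompGrp.{u}) : AbComp.{u} where
  obj := quot (closedDerived G) (isClosed_closedDerived G)
  property := by
    intro x y
    obtain ⟨a, rfl⟩ := quotMk_surjective _ _ x
    obtain ⟨b, rfl⟩ := quotMk_surjective _ _ y
    rw [← map_mul, ← map_mul]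
    refine QuotientGroup.eq.mpr (Subgroup.le_topologicalClosure _ ?_)
    have h : (a * b)⁻¹ * (b * a) = ⁅b⁻¹, a⁻¹⁆ := by
      simp only [commutatorElement_def]
      group
    rw [h]
    exact Subgroup.commutator_mem_commutator (Subgroup.mem_top _) (Subgroup.mem_top _)

open scoped commutatorElement in
lemma hom_closedDerived {G A : CompGrp.{u}} (hA : isAbelian A) (f : G ⟶ A) :
    ∀ x ∈ closedDerived G, f.hom x = 1 := by
  have h1 : commutator G ≤ f.hom.toMonoidHom.ker := by
    refine Subgroup.commutator_le.mpr fun a _ b _ => ?_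
    rw [MonoidHom.mem_ker, map_commutatorElement, commutatorElement_eq_one_iff_mul_comm]
    exact hA _ _
  have h2 : closedDerived G ≤ f.hom.toMonoidHom.ker :=
    Subgroup.topologicalClosure_minimal _ h1
      (isClosed_singleton.preimage f.hom.continuous_toFun)
  exact fun x hx => h2 hx

/-- The universal property of the abelianization. -/
def abEquiv (G : CompGrp.{u}) (A : AbComp.{u}) :
    (abObj G ⟶ A) ≃ (G ⟶ isAbelian.ι.obj A) where
  toFun f := quotMk _ (isClosed_closedDerived G) ≫ f.hom
  invFun f := ObjectProperty.homMk (quotLift _ (isClosed_closedDerived G) f (hom_closedDerived A.property f))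
  left_inv f := by
    apply ObjectProperty.hom_ext
    ext x
    obtain ⟨a, rfl⟩ := quotMk_surjective (closedDerived G) (isClosed_closedDerived G) x
    rfl
  right_inv f := rfl

/-- The reflector `ab : Grp(HComp) ⥤ Ab(HComp)`. -/
def ab : CompGrp.{u} ⥤ AbComp.{u} :=
  Adjunction.leftAdjointOfEquiv abEquiv (fun _ _ _ _ _ => rfl)

/-- The adjunction between `ab` and the inclusion. -/
def abAdj : ab.{u} ⊣ isAbelian.{u}.ι :=
  Adjunction.adjunctionOfEquivLeft abEquiv (fun _ _ _ _ _ => rfl)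

/-- The identity component, as a normal subgroup. -/
def idComp (G : CompGrp.{u}) : Subgroup G := Subgroup.connectedComponentOfOne G

lemma isClosed_idComp (G : CompGrp.{u}) : IsClosed (idComp G : Set G) :=
  isClosed_connectedComponent

instance (G : CompGrp.{u}) : (idComp G).Normal where
  conj_mem x hx g := by
    have hc : Continuous fun y : G => g * y * g⁻¹ := by fun_prop
    have := hc.image_connectedComponent_subset (1 : G) ⟨x, hx, rfl⟩
    simpa [idComp, Subgroup.connectedComponentOfOne] using this

lemma hom_idComp {G A : CompGrp.{u}} [TotallyDisconnectedSpace A] (f : G ⟶ A) :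
    ∀ x ∈ idComp G, f.hom x = 1 := by
  intro x hx
  have := f.hom.continuous_toFun.image_connectedComponent_subset (1 : G) ⟨x, hx, rfl⟩
  rw [totallyDisconnectedSpace_iff_connectedComponent_singleton.mp inferInstance] at this
  exact this.trans (map_one f.hom)

lemma totallyDisconnected_quot_idComp (G : CompGrp.{u}) :
    TotallyDisconnectedSpace (quot (idComp G) (isClosed_idComp G)) := by
  have key : ∀ a : G, (QuotientGroup.mk : G → G ⧸ idComp G) ⁻¹' {QuotientGroup.mk a} =
      connectedComponent a := by
    intro a
    have h := smul_connectedComponent a (1 : G)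
    rw [mul_one] at h
    rw [← h]
    ext b
    rw [Set.mem_smul_set_iff_inv_smul_mem, Set.mem_preimage, Set.mem_singleton_iff, eq_comm,
      QuotientGroup.eq]
    rfl
  refine totallyDisconnectedSpace_iff_connectedComponent_singleton.mpr ?_
  change ∀ x : G ⧸ idComp G, connectedComponent x = {x}
  have hc : Topology.IsQuotientMap (QuotientGroup.mk : G → G ⧸ idComp G) :=
    QuotientGroup.isQuotientMap_mk (N := idComp G)
  have hfib : ∀ y : G ⧸ idComp G, IsConnected ((QuotientGroup.mk : G → G ⧸ idComp G) ⁻¹' {y}) := by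
    intro y
    obtain ⟨a, rfl⟩ := QuotientGroup.mk_surjective y
    rw [key]
    exact isConnected_connectedComponent
  intro x
  obtain ⟨a, rfl⟩ := QuotientGroup.mk_surjective x
  rw [← hc.isCoinducing.image_connectedComponent hfib, ← key,
    Set.image_preimage_eq _ QuotientGroup.mk_surjective]

/-- The reflection `A / A₀` of an abelian compact group `A`. -/
def profObj (A : AbComp.{u}) : AbProf.{u} where
  obj :=
    { obj := quot (idComp A.obj) (isClosed_idComp A.obj)
      property := by
        intro x y
        obtain ⟨a, rfl⟩ := quotMk_surjective _ _ x
        obtain ⟨b, rfl⟩ := quotMk_surjective _ _ y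
        rw [← map_mul, ← map_mul, A.property a b] }
  property := totallyDisconnected_quot_idComp A.obj

/-- The universal property of `A / A₀`. -/
def profEquiv (A : AbComp.{u}) (C : AbProf.{u}) :
    (profObj A ⟶ C) ≃ (A ⟶ isProfinite.ι.obj C) where
  toFun f := ObjectProperty.homMk (quotMk _ (isClosed_idComp A.obj) ≫ f.hom.hom)
  invFun f := ObjectProperty.homMk (ObjectProperty.homMk
    (quotLift (H := C.obj.obj) _ (isClosed_idComp A.obj) f.hom
      (have : TotallyDisconnectedSpace C.obj.obj := C.property
       hom_idComp (A := C.obj.obj) f.hom)))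
  left_inv f := by
    apply ObjectProperty.hom_ext
    apply ObjectProperty.hom_ext
    ext x
    obtain ⟨a, rfl⟩ := quotMk_surjective (idComp A.obj) (isClosed_idComp A.obj) x
    rfl
  right_inv f := rfl

/-- The reflector `F : Ab(HComp) ⥤ Ab(Prof)`. -/
def prof : AbComp.{u} ⥤ AbProf.{u} :=
  Adjunction.leftAdjointOfEquiv profEquiv (fun _ _ _ _ _ => rfl)

/-- The adjunction between `F` and the inclusion. -/
def profAdj : prof.{u} ⊣ isProfinite.{u}.ι :=
  Adjunction.adjunctionOfEquivLeft profEquiv (fun _ _ _ _ _ => rfl)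

/-- The composite reflector `Grp(HComp) ⥤ Ab(Prof)`. -/
def reflector : CompGrp.{u} ⥤ AbProf.{u} := ab ⋙ prof

/-- The inclusion `Ab(Prof) ⥤ Grp(HComp)`. -/
def incl : AbProf.{u} ⥤ CompGrp.{u} := isProfinite.ι ⋙ isAbelian.ι

instance : incl.{u}.Full := inferInstanceAs (isProfinite.{u}.ι ⋙ isAbelian.{u}.ι).Full

instance : incl.{u}.Faithful := inferInstanceAs (isProfinite.{u}.ι ⋙ isAbelian.{u}.ι).Faithful

/-- The composite adjunction. -/
def reflectorAdj : reflector.{u} ⊣ incl.{u} := abAdj.comp profAdj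

lemma unit_surjective (G : CompGrp.{u}) :
    Function.Surjective (Hom.hom (reflectorAdj.unit.app G)) := by
  have h : Hom.hom (reflectorAdj.unit.app G) =
      Hom.hom (quotMk _ (isClosed_closedDerived G) ≫
        quotMk _ (isClosed_idComp (abObj G).obj)) := rfl
  rw [h]
  exact (quotMk_surjective _ (isClosed_idComp _)).comp (quotMk_surjective _ _)

/-- The Galois structure of the reflection `Grp(HComp) ⥤ Ab(Prof)`, with the regular epimorphisms
as extensions. -/
def galoisStructure : GaloisStructure CompGrp.{u} AbProf.{u} where
  I := reflector
  H := incl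
  adj := reflectorAdj
  full := inferInstance
  faithful := inferInstance
  E := MorphismProperty.regularEpi CompGrp.{u}
  map_mem {X Y} f hf := by
    rw [MorphismProperty.regularEpi_iff, isRegularEpi_iff_surjective] at hf ⊢
    have h : f ≫ reflectorAdj.unit.app Y =
        reflectorAdj.unit.app X ≫ incl.map (reflector.map f) := reflectorAdj.unit.naturality f
    have hs : Function.Surjective (f ≫ reflectorAdj.unit.app Y).hom :=
      (unit_surjective Y).comp hf
    rw [h] at hs
    exact Function.Surjective.of_comp (g := Hom.hom (reflectorAdj.unit.app X)) hs
  isMultiplicative := inferInstance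
  isStableUnderBaseChange := inferInstance

instance : HasFiniteLimits AbProf.{u} where
  out _ _ _ :=
    have : Reflective incl.{u} := ⟨reflector, reflectorAdj⟩
    hasLimitsOfShape_of_reflective incl.{u}

instance : HasZeroObject AbProf.{u} :=
  ⟨⟨⟨of PUnit.{u + 1}, fun _ _ => rfl⟩, inferInstanceAs (TotallyDisconnectedSpace PUnit)⟩,
    ⟨fun Y => ⟨⟨⟨ObjectProperty.homMk (ObjectProperty.homMk 0)⟩, fun f => by
        apply ObjectProperty.hom_ext
        apply ObjectProperty.hom_ext
        exact isZero_punit.eq_of_src _ _⟩⟩,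
      fun Y => ⟨⟨⟨ObjectProperty.homMk (ObjectProperty.homMk 0)⟩, fun f => by
        apply ObjectProperty.hom_ext
        apply ObjectProperty.hom_ext
        exact isZero_punit.eq_of_tgt _ _⟩⟩⟩⟩

/-! ### The right-hand side of the Hopf formula -/

variable {P : CompGrp.{u}} (K : Subgroup P)

/-- `K ∧ (cl[P, P] · P₀)`; the product of two normal subgroups is their supremum. -/
def hopfNum : Subgroup P := K ⊓ (closedDerived P ⊔ idComp P)

/-- The identity component `K₀` of the group `K` (with its subspace topology), as a subgroup
of `P`. -/
def idCompOf : Subgroup P := (Subgroup.connectedComponentOfOne K).map K.subtype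

/-- `cl[K, P] · K₀`; the product of two normal subgroups is their supremum. -/
def hopfDen : Subgroup P := (⁅K, (⊤ : Subgroup P)⁆).topologicalClosure ⊔ idCompOf K

instance [hK : K.Normal] : (idCompOf K).Normal where
  conj_mem := by
    rintro _ ⟨x, hx, rfl⟩ g
    have hc : Continuous fun y : K => (⟨g * y * g⁻¹, hK.conj_mem y y.2 g⟩ : K) := by fun_prop
    refine ⟨⟨g * x * g⁻¹, hK.conj_mem x x.2 g⟩, ?_, rfl⟩
    have := hc.image_connectedComponent_subset (1 : K) ⟨x, hx, rfl⟩
    have h1 : (⟨g * (1 : K) * g⁻¹, hK.conj_mem _ (1 : K).2 g⟩ : K) = 1 := by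
      apply Subtype.ext
      simp
    rw [h1] at this
    exact this

instance [K.Normal] : (hopfDen K).Normal :=
  have : ((⁅K, (⊤ : Subgroup P)⁆).topologicalClosure).Normal :=
    Subgroup.is_normal_topologicalClosure _
  Subgroup.sup_normal _ _

/-- The topological group `(K ∧ (cl[P, P] · P₀)) / (cl[K, P] · K₀)`. -/
abbrev HopfQuotient [K.Normal] : Type u := hopfNum K ⧸ (hopfDen K).subgroupOf (hopfNum K)

end CompGrp

/-! Write R(G) = cl[G, G] · G₀ for the kernel of the unit G → I(G) (`radical_eq`). Quotients of
compact totally disconnected groups are totally disconnected, so a surjection G → H carries R(G)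
onto R(H) (`exists_mem_radical`). Hence a surjection f is a trivial extension iff Ker f ∩ R(X) = 1
(`isTrivialExtension_iff`).

Every surjection is a monadic extension, so normality is a condition on the kernel pair only, and it
says that Ker p is central and totally disconnected (`isNormalExtension_iff`). The main tool is
`IsCentralProfinite.eq_on_radical`: if a, b : Y → X agree over B, then y ↦ a(y)⁻¹b(y) is a
homomorphism into the abelian profinite group Ker p, so it kills R(Y).

For normal p the Galois group is Ker p ∩ R(E), embedded in I(E ×_B E) by the class of (1, n)
(`IsCentralProfinite.isPullback`). Two normal extensions with maps over B in both directions have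
the same such group, again by comparing the composites with identities on radicals
(`kerRadicalIso`). It therefore suffices to compute one weakly universal example, and P / (cl[K, P]
· K₀) → B is one: a lift of f given by projectivity of P kills cl[K, P] · K₀ (`hom_hopfDen`). Its
kernel meets its radical in the image of K ∩ R(P), which is the right-hand side of the formula. -/

namespace CompGrp

/-! ### Surjections and pullbacks, elementwise -/

/-- A morphism that kills the kernel of a surjection factors through it. -/
lemma exists_desc {X Y Z : CompGrp.{u}} {q : X ⟶ Y} (hq : Function.Surjective q.hom) (k : X ⟶ Z)
    (h : ∀ x, q.hom x = 1 → k.hom x = 1) : ∃ l : Y ⟶ Z, q ≫ l = k := by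
  have hQ : Topology.IsQuotientMap q.hom :=
    q.hom.continuous_toFun.isClosedMap.isQuotientMap q.hom.continuous_toFun hq
  let l : Y →* Z := (q.hom.toMonoidHom.liftOfSurjective hq) ⟨k.hom.toMonoidHom, fun x hx => h x hx⟩
  have hl : ∀ x, l (q.hom x) = k.hom x := fun x =>
    MonoidHom.liftOfRightInverse_comp_apply (f := q.hom.toMonoidHom) (g := ⟨k.hom.toMonoidHom, _⟩) ..
  refine ⟨ofHom ⟨l, hQ.continuous_iff.mpr (k.hom.continuous_toFun.congr fun x => (hl x).symm)⟩, ?_⟩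
  ext x
  exact hl x

lemma quotMk_eq_one_iff {G : CompGrp.{u}} (N : Subgroup G) [N.Normal] (hN : IsClosed (N : Set G))
    {x : G} : (quotMk N hN).hom x = 1 ↔ x ∈ N := QuotientGroup.eq_one_iff x

lemma epi_of_surjective {X Y : CompGrp.{u}} {q : X ⟶ Y} (hq : Function.Surjective q.hom) :
    Epi q := ⟨fun a b h => by
  ext y
  obtain ⟨x, rfl⟩ := hq y
  exact congrArg (fun k => Hom.hom k x) h⟩

lemma isIso_of_bijective {X Y : CompGrp.{u}} {q : X ⟶ Y} (hq : Function.Bijective q.hom) :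
    IsIso q := by
  obtain ⟨l, hl⟩ := exists_desc hq.2 (𝟙 X) fun x hx => hq.1 (hx.trans (map_one q.hom).symm)
  have := epi_of_surjective hq.2
  exact ⟨l, hl, by rw [← cancel_epi q, ← Category.assoc, hl, Category.id_comp, Category.comp_id]⟩

lemma injective_of_isIso {X Y : CompGrp.{u}} (f : X ⟶ Y) [IsIso f] :
    Function.Injective f.hom :=
  Function.LeftInverse.injective (g := (inv f).hom) fun x =>
    congrArg (fun k : X ⟶ X => k.hom x) (IsIso.hom_inv_id f)

section

variable {W X Y Z : CompGrp.{u}} {a : W ⟶ X} {b : W ⟶ Y} {f : X ⟶ Z} {g : Y ⟶ Z}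

lemma isPullback_exists (h : IsPullback a b f g) (x : X) (y : Y) (hxy : f.hom x = g.hom y) :
    ∃ w : W, a.hom w = x ∧ b.hom w = y := by
  let t := h.lift (fibreFst f g) (fibreSnd f g) (isPullback_fibre f g).w
  refine ⟨t.hom ⟨(x, y), hxy⟩, ?_, ?_⟩
  · exact congrArg (fun l : fibre f g ⟶ _ => l.hom ⟨(x, y), hxy⟩) (h.lift_fst _ _ _)
  · exact congrArg (fun l : fibre f g ⟶ _ => l.hom ⟨(x, y), hxy⟩) (h.lift_snd _ _ _)

lemma isPullback_ext (h : IsPullback a b f g) {w w' : W} (ha : a.hom w = a.hom w')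
    (hb : b.hom w = b.hom w') : w = w' := by
  have e₁ := h.isoIsPullback_hom_fst _ _ (isPullback_fibre f g)
  have e₂ := h.isoIsPullback_hom_snd _ _ (isPullback_fibre f g)
  refine injective_of_isIso (h.isoIsPullback _ _ (isPullback_fibre f g)).hom
    (Subtype.ext (Prod.ext ?_ ?_))
  · exact (congrArg (fun l => Hom.hom l w) e₁).trans
      (ha.trans (congrArg (fun l => Hom.hom l w') e₁).symm)
  · exact (congrArg (fun l => Hom.hom l w) e₂).trans
      (hb.trans (congrArg (fun l => Hom.hom l w') e₂).symm)

/-- The comparison with the explicit fibre product is a continuous bijective homomorphism of compact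
Hausdorff groups, hence an isomorphism. For homomorphisms, uniqueness need only be tested at 1. -/
lemma isPullback_of_elementwise (w : a ≫ f = b ≫ g)
    (hex : ∀ x y, f.hom x = g.hom y → ∃ w, a.hom w = x ∧ b.hom w = y)
    (hext : ∀ w, a.hom w = 1 → b.hom w = 1 → w = 1) : IsPullback a b f g := by
  let t := (isPullback_fibre f g).lift a b w
  have ht : Function.Bijective t.hom := by
    have h1 : ∀ w', (fibreFst f g).hom (t.hom w') = a.hom w' := fun w' =>
      congrArg (fun l => Hom.hom l w') ((isPullback_fibre f g).lift_fst a b w)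
    have h2 : ∀ w', (fibreSnd f g).hom (t.hom w') = b.hom w' := fun w' =>
      congrArg (fun l => Hom.hom l w') ((isPullback_fibre f g).lift_snd a b w)
    refine ⟨(injective_iff_map_eq_one t.hom).mpr fun x hx => hext x ?_ ?_, fun z => ?_⟩
    · rw [← h1, hx, map_one]
    · rw [← h2, hx, map_one]
    · obtain ⟨x, hx, hy⟩ := hex _ _ z.2
      exact ⟨x, isPullback_ext (isPullback_fibre f g) ((h1 x).trans hx) ((h2 x).trans hy)⟩
  have := isIso_of_bijective ht
  exact IsPullback.of_iso_pullback ⟨w⟩ (asIso t ≪≫ (isPullback_fibre f g).isoPullback)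
    (by simp [t]) (by simp [t])

end

/-! ### Surjections are monadic extensions -/

/-- The category of extensions of `B`. -/
abbrev Ext (B : CompGrp.{u}) := (MorphismProperty.regularEpi CompGrp.{u}).Over ⊤ B

lemma Ext.hom_surjective {B : CompGrp.{u}} (Y : Ext B) : Function.Surjective Y.hom.hom :=
  (isRegularEpi_iff_surjective _).mp Y.prop

lemma Ext.hom_left_apply {B : CompGrp.{u}} {Y Z : Ext B} (f : Y ⟶ Z) (y : Y.left) :
    Z.hom.hom (f.left.hom y) = Y.hom.hom y :=
  congrArg (fun l => Hom.hom l y) (MorphismProperty.Over.w f)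

lemma Ext.isIso_of_bijective {B : CompGrp.{u}} {Y Z : Ext B} (f : Y ⟶ Z)
    (hf : Function.Bijective f.left.hom) : IsIso f := by
  have := CompGrp.isIso_of_bijective hf
  exact (MorphismProperty.Over.isoMk (asIso f.left) (MorphismProperty.Over.w f)).isIso_hom

/-- Recognition of coequalizers of extensions. -/
lemma Ext.nonempty_isColimit {B : CompGrp.{u}} {Y Z Q : Ext B} {f g : Y ⟶ Z} (q : Z ⟶ Q)
    (w : f ≫ q = g ≫ q) (hq : Function.Surjective q.left.hom)
    (hk : ∀ z, q.left.hom z = 1 → ∃ y, f.left.hom y = z ∧ g.left.hom y = 1) :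
    Nonempty (IsColimit (Cofork.ofπ q w)) := by
  have hepi := epi_of_surjective hq
  refine ⟨Cofork.IsColimit.mk' _ fun s => ?_⟩
  have hl : ∃ l : Q.left ⟶ s.pt.left, q.left ≫ l = s.π.left := by
    refine exists_desc hq _ fun z hz => ?_
    obtain ⟨y, rfl, hy⟩ := hk z hz
    have hs := congrArg (fun l : Y ⟶ s.pt => l.left.hom y) s.condition
    exact hs.trans ((congrArg s.π.left.hom hy).trans (map_one _))
  let l := hl.choose
  have hl : q.left ≫ l = s.π.left := hl.choose_spec
  refine ⟨MorphismProperty.Over.homMk l ?_, ?_, ?_⟩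
  · rw [← cancel_epi q.left, ← Category.assoc, hl]
    exact (MorphismProperty.Over.w s.π).trans (MorphismProperty.Over.w q).symm
  · ext1
    exact hl
  · intro m hm
    ext1
    rw [← cancel_epi q.left]
    exact (congrArg (fun t : Z ⟶ s.pt => t.left) hm).trans hl.symm

/-- A reflexive pair of extensions of `B` has a coequalizer in the form in which it is
recognised by `Ext.nonempty_isColimit`. -/
lemma Ext.exists_coequalizer {B : CompGrp.{u}} {Y Z : Ext B} (f g : Y ⟶ Z) [IsReflexivePair f g] :
    ∃ (Q : Ext B) (q : Z ⟶ Q), f ≫ q = g ≫ q ∧ Function.Surjective q.left.hom ∧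
      ∀ z, q.left.hom z = 1 → ∃ y, f.left.hom y = z ∧ g.left.hom y = 1 := by
  obtain ⟨s, hsf, hsg⟩ := IsReflexivePair.common_section f g
  have hsf' : ∀ z, f.left.hom (s.left.hom z) = z := fun z =>
    congrArg (fun l : Z ⟶ Z => l.left.hom z) hsf
  have hsg' : ∀ z, g.left.hom (s.left.hom z) = z := fun z =>
    congrArg (fun l : Z ⟶ Z => l.left.hom z) hsg
  -- The coequalizer is the quotient by f(Ker g). Compactness makes this subgroup closed, and the
  -- common section s makes it normal: conjugation by z lifts to conjugation by s(z), which
  -- preserves Ker g.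
  let N : Subgroup Z.left := g.left.hom.toMonoidHom.ker.map f.left.hom.toMonoidHom
  have hmem : ∀ {z}, z ∈ N ↔ ∃ y, f.left.hom y = z ∧ g.left.hom y = 1 := fun {z} =>
    ⟨fun ⟨y, hy, h⟩ => ⟨y, h, hy⟩, fun ⟨y, h, hy⟩ => ⟨y, hy, h⟩⟩
  have hN : IsClosed (N : Set Z.left) :=
    ((isClosed_singleton.preimage g.left.hom.continuous_toFun).isCompact.image
      f.left.hom.continuous_toFun).isClosed
  have hnormal : N.Normal := by
    refine ⟨fun n hn z => ?_⟩
    obtain ⟨y, rfl, hy⟩ := hmem.mp hn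
    refine hmem.mpr ⟨s.left.hom z * y * (s.left.hom z)⁻¹, ?_, ?_⟩
    · rw [map_mul, map_mul, map_inv, hsf']
    · rw [map_mul, map_mul, map_inv, hsg', hy]
      group
  have hZ : ∀ x ∈ N, Z.hom.hom x = 1 := by
    intro x hx
    obtain ⟨y, rfl, hy⟩ := hmem.mp hx
    rw [Ext.hom_left_apply, ← Ext.hom_left_apply g, hy, map_one]
  let Q : Ext B := MorphismProperty.Over.mk ⊤ (quotLift N hN Z.hom hZ) (by
    rw [MorphismProperty.regularEpi_iff, isRegularEpi_iff_surjective]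
    intro b
    obtain ⟨z, rfl⟩ := Z.hom_surjective b
    exact ⟨(quotMk N hN).hom z, rfl⟩)
  let q : Z ⟶ Q := MorphismProperty.Over.homMk (quotMk N hN) rfl
  refine ⟨Q, q, ?_, quotMk_surjective N hN, fun z hz =>
    hmem.mp ((quotMk_eq_one_iff _ _).mp hz)⟩
  ext y
  -- The element y⁻¹ · s(g y) lies in Ker g, and f sends it to (f y)⁻¹ · g y.
  refine QuotientGroup.eq.mpr (hmem.mpr
    ⟨y⁻¹ * s.left.hom (g.left.hom y), ?_, ?_⟩)
  · rw [map_mul, map_inv, hsf']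
    rfl
  · rw [map_mul, map_inv, hsg', inv_mul_cancel]

instance (B : CompGrp.{u}) : HasReflexiveCoequalizers (Ext B) where
  has_coeq _ _ f g _ := by
    obtain ⟨Q, q, w, hq, hk⟩ := Ext.exists_coequalizer f g
    obtain ⟨h⟩ := Ext.nonempty_isColimit q w hq hk
    exact ⟨⟨_, h⟩⟩

/-! ### Pulling back extensions is monadic -/

section

variable {X B : CompGrp.{u}} (p : X ⟶ B)

/-- Pulling back extensions. -/
noncomputable abbrev pullbackExt : Ext B ⥤ Ext X :=
  MorphismProperty.Over.pullback (MorphismProperty.regularEpi CompGrp.{u}) ⊤ p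

/-- The projection from a pulled back extension. -/
noncomputable def pullbackExtFst (Y : Ext B) : ((pullbackExt p).obj Y).left ⟶ Y.left :=
  pullback.fst Y.hom p

lemma pullbackExt_exists (Y : Ext B) (y : Y.left) (x : X) (h : Y.hom.hom y = p.hom x) :
    ∃ t : ((pullbackExt p).obj Y).left, (pullbackExtFst p Y).hom t = y ∧
      ((pullbackExt p).obj Y).hom.hom t = x :=
  isPullback_exists (IsPullback.of_hasPullback Y.hom p) y x h

lemma pullbackExt_ext {Y : Ext B} {t t' : ((pullbackExt p).obj Y).left}
    (h₁ : (pullbackExtFst p Y).hom t = (pullbackExtFst p Y).hom t')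
    (h₂ : ((pullbackExt p).obj Y).hom.hom t = ((pullbackExt p).obj Y).hom.hom t') : t = t' :=
  isPullback_ext (IsPullback.of_hasPullback Y.hom p) h₁ h₂

lemma pullbackExt_w {Y : Ext B} (t : ((pullbackExt p).obj Y).left) :
    Y.hom.hom ((pullbackExtFst p Y).hom t) = p.hom (((pullbackExt p).obj Y).hom.hom t) :=
  congrArg (fun l => Hom.hom l t) (pullback.condition (f := Y.hom) (g := p))

lemma pullbackExt_map_fst {Y Z : Ext B} (f : Y ⟶ Z) (t : ((pullbackExt p).obj Y).left) :
    (pullbackExtFst p Z).hom (((pullbackExt p).map f).left.hom t) =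
      f.left.hom ((pullbackExtFst p Y).hom t) :=
  congrArg (fun l => Hom.hom l t)
    (pullback.lift_fst (pullback.fst Y.hom p ≫ f.left) (pullback.snd Y.hom p) _)

variable {p}

/-- A kernel element y lies over 1, so (y, 1) is in the kernel of the pulled back map and is
trivial. Surjectivity descends because each z is the first component of some (z, x), as `p` is
surjective. -/
lemma pullbackExt_reflectsIsomorphisms (hp : Function.Surjective p.hom) :
    (pullbackExt p).ReflectsIsomorphisms := by
  have hmap : ∀ {Y Z : Ext B} (f : Y ⟶ Z) [IsIso ((pullbackExt p).map f)],
      Function.Bijective ((pullbackExt p).map f).left.hom := fun {Y Z} f _ => by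
    have : IsIso ((pullbackExt p).map f).left :=
      inferInstanceAs (IsIso ((MorphismProperty.Over.forget _ _ _ ⋙ Over.forget X).map
        ((pullbackExt p).map f)))
    exact ⟨injective_of_isIso _, surjective_of_isIso _⟩
  refine ⟨fun {Y Z} f _ => Ext.isIso_of_bijective f ⟨?_, fun z => ?_⟩⟩
  · refine (injective_iff_map_eq_one f.left.hom).mpr fun y hy => ?_
    have hy' : Y.hom.hom y = 1 := by rw [← Ext.hom_left_apply f, hy, map_one]
    obtain ⟨t, rfl, ht⟩ := pullbackExt_exists p Y y 1 (hy'.trans (map_one _).symm)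
    have : t = 1 := (hmap f).1 <| by
      rw [map_one]
      refine pullbackExt_ext p ?_ ?_
      · rw [pullbackExt_map_fst, hy, map_one]
      · rw [Ext.hom_left_apply, ht, map_one]
    rw [this, map_one]
  · obtain ⟨x, hx⟩ := hp (Z.hom.hom z)
    obtain ⟨t, rfl, ht⟩ := pullbackExt_exists p Z z x hx.symm
    obtain ⟨t', rfl⟩ := (hmap f).2 t
    exact ⟨_, (pullbackExt_map_fst p f t').symm⟩

/-- The criterion of `Ext.nonempty_isColimit` (q surjective, Ker q covered by f(Ker g)) is stable
under pullback: an element of the new kernel has the form (z, 1), and a witness y for z gives the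
witness (y, 1). -/
lemma pullbackExt_preserves : Monad.PreservesColimitOfIsReflexivePair (pullbackExt p) := by
  refine ⟨fun {Y Z} f g _ => ?_⟩
  obtain ⟨Q, q, w, hq, hk⟩ := Ext.exists_coequalizer f g
  obtain ⟨h⟩ := Ext.nonempty_isColimit q w hq hk
  have w' : (pullbackExt p).map f ≫ (pullbackExt p).map q =
      (pullbackExt p).map g ≫ (pullbackExt p).map q := by
    rw [← Functor.map_comp, w, Functor.map_comp]
  have hsurj : Function.Surjective ((pullbackExt p).map q).left.hom := by
    intro t
    obtain ⟨z, hz⟩ := hq ((pullbackExtFst p Q).hom t)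
    obtain ⟨t', h₁, h₂⟩ := pullbackExt_exists p Z z (((pullbackExt p).obj Q).hom.hom t)
      (by rw [← Ext.hom_left_apply q, hz, pullbackExt_w])
    refine ⟨t', pullbackExt_ext p ?_ ?_⟩
    · rw [pullbackExt_map_fst, h₁, hz]
    · rw [Ext.hom_left_apply, h₂]
  have hker : ∀ t, ((pullbackExt p).map q).left.hom t = 1 → ∃ t',
      ((pullbackExt p).map f).left.hom t' = t ∧ ((pullbackExt p).map g).left.hom t' = 1 := by
    intro t ht
    obtain ⟨y, h₁, h₂⟩ := hk ((pullbackExtFst p Z).hom t)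
      (by rw [← pullbackExt_map_fst, ht, map_one])
    have ht' : ((pullbackExt p).obj Z).hom.hom t = 1 := by
      rw [← Ext.hom_left_apply ((pullbackExt p).map q), ht, map_one]
    obtain ⟨t', rfl, h₃⟩ := pullbackExt_exists p Y y 1
      (by rw [← Ext.hom_left_apply g, h₂, map_one, map_one])
    refine ⟨t', pullbackExt_ext p ?_ ?_, pullbackExt_ext p ?_ ?_⟩
    · rw [pullbackExt_map_fst, h₁]
    · rw [Ext.hom_left_apply, h₃, ht']
    · rw [pullbackExt_map_fst, h₂, map_one]
    · rw [Ext.hom_left_apply, h₃, map_one]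
  obtain ⟨h'⟩ := Ext.nonempty_isColimit ((pullbackExt p).map q) w' hsurj hker
  exact preservesColimit_of_preserves_colimit_cocone h
    ((isColimitMapCoconeCoforkEquiv (pullbackExt p) w).symm h')

/-- This is the reflexive monadicity theorem. The left adjoint is composition with `p`, which stays
within extensions because `p` is one. -/
lemma isMonadicExtension_of_surjective (hp : Function.Surjective p.hom) :
    galoisStructure.{u}.IsMonadicExtension p := by
  have hp' : MorphismProperty.regularEpi CompGrp.{u} p := (isRegularEpi_iff_surjective p).mpr hp
  have := pullbackExt_reflectsIsomorphisms hp
  have := pullbackExt_preserves (p := p)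
  have h : MonadicRightAdjoint (pullbackExt p) :=
    Monad.monadicOfHasPreservesReflexiveCoequalizersOfReflectsIsomorphisms
      (MorphismProperty.Over.mapPullbackAdj (MorphismProperty.regularEpi CompGrp.{u}) ⊤ p hp'
        trivial)
  exact ⟨hp', ⟨h⟩⟩

end

/-! ### The kernel of the unit -/

lemma totallyDisconnected_of_connectedComponent_one {H : CompGrp.{u}}
    (h : ∀ y ∈ connectedComponent (1 : H), y = 1) : TotallyDisconnectedSpace H := by
  refine totallyDisconnectedSpace_iff_connectedComponent_singleton.mpr fun x => ?_
  have hx := smul_connectedComponent x (1 : H)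
  rw [mul_one] at hx
  rw [← hx, (Set.subset_singleton_iff.mpr h).antisymm
    (Set.singleton_subset_iff.mpr mem_connectedComponent)]
  simp

/-- A quotient of a profinite group is profinite. -/
lemma totallyDisconnected_of_surjective {G H : CompGrp.{u}} [TotallyDisconnectedSpace G]
    (q : G ⟶ H) (hq : Function.Surjective q.hom) : TotallyDisconnectedSpace H := by
  have hQ : Topology.IsQuotientMap q.hom :=
    q.hom.continuous_toFun.isClosedMap.isQuotientMap q.hom.continuous_toFun hq
  have hopen : IsOpenMap q.hom := (MonoidHom.isOpenQuotientMap_of_isQuotientMap hQ).isOpenMap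
  refine totallyDisconnected_of_connectedComponent_one fun y hy => ?_
  by_contra hne
  -- An open normal subgroup of `G` that avoids the fibre over y has an open, hence clopen, image.
  -- That image contains the identity component but not y.
  have hU : IsOpen (q.hom ⁻¹' {y}ᶜ) := isOpen_compl_singleton.preimage q.hom.continuous_toFun
  obtain ⟨N, hN⟩ := ProfiniteGrp.exist_openNormalSubgroup_sub_open_nhds_of_one hU
    (show q.hom 1 ≠ y by rw [map_one]; exact Ne.symm hne)
  let M : Subgroup H := (N : Subgroup G).map q.hom.toMonoidHom
  have hM : IsOpen (M : Set H) := hopen _ N.isOpen'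
  have hclopen : IsClopen (M : Set H) := ⟨M.isClosed_of_isOpen hM, hM⟩
  obtain ⟨x, hx, rfl⟩ := hclopen.connectedComponent_subset M.one_mem hy
  exact hN hx rfl

/-- The unit `G ⟶ I(G)`. -/
def toReflection (G : CompGrp.{u}) : G ⟶ incl.obj (reflector.obj G) := reflectorAdj.unit.app G

lemma toReflection_surjective (G : CompGrp.{u}) : Function.Surjective (toReflection G).hom :=
  unit_surjective G

/-- The kernel of the unit `G ⟶ I(G)`. -/
def radical (G : CompGrp.{u}) : Subgroup G :=
  (toReflection G).hom.toMonoidHom.ker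

lemma mem_radical {G : CompGrp.{u}} {x : G} :
    x ∈ radical G ↔ (toReflection G).hom x = 1 := Iff.rfl

instance (G : CompGrp.{u}) : (radical G).Normal := MonoidHom.normal_ker _

lemma isClosed_radical (G : CompGrp.{u}) : IsClosed (radical G : Set G) :=
  isClosed_singleton.preimage (toReflection G).hom.continuous_toFun

lemma toReflection_naturality {G H : CompGrp.{u}} (f : G ⟶ H) (x : G) :
    (toReflection H).hom (f.hom x) =
      Hom.hom (incl.map (reflector.map f)) ((toReflection G).hom x) :=
  congrArg (fun l => Hom.hom l x) (reflectorAdj.unit.naturality f)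

lemma map_mem_radical {G H : CompGrp.{u}} (f : G ⟶ H) {x : G} (hx : x ∈ radical G) :
    f.hom x ∈ radical H := by
  rw [mem_radical] at hx ⊢
  rw [toReflection_naturality, hx, map_one]

lemma hom_radical {G A : CompGrp.{u}} (hA : isAbelian A) [hd : TotallyDisconnectedSpace A]
    (f : G ⟶ A) {x : G} (hx : x ∈ radical G) : f.hom x = 1 := by
  let C : AbProf.{u} := ⟨⟨A, hA⟩, hd⟩
  let g : incl.obj (reflector.obj G) ⟶ A := incl.map ((reflectorAdj.homEquiv G C).symm f)
  have h : toReflection G ≫ g = f :=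
    (reflectorAdj.homEquiv_unit G C _).symm.trans (Equiv.apply_symm_apply _ f)
  rw [mem_radical] at hx
  rw [← h, comp_apply, hx, map_one]

lemma isAbelian_of_surjective {G H : CompGrp.{u}} (hG : isAbelian G) (q : G ⟶ H)
    (hq : Function.Surjective q.hom) : isAbelian H := by
  intro x y
  obtain ⟨a, rfl⟩ := hq x
  obtain ⟨b, rfl⟩ := hq y
  rw [← map_mul, hG, map_mul]

lemma isAbelian_incl (C : AbProf.{u}) : isAbelian (incl.obj C) := C.obj.property

instance (C : AbProf.{u}) : TotallyDisconnectedSpace (incl.obj C) := C.property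

/-- Surjections restrict to surjections between radicals. -/
lemma exists_mem_radical {G H : CompGrp.{u}} {f : G ⟶ H} (hf : Function.Surjective f.hom) {y : H}
    (hy : y ∈ radical H) : ∃ x ∈ radical G, f.hom x = y := by
  let N : Subgroup H := (radical G).map f.hom.toMonoidHom
  have hN : IsClosed (N : Set H) :=
    ((isClosed_radical G).isCompact.image f.hom.continuous_toFun).isClosed
  have : N.Normal := Subgroup.Normal.map inferInstance _ hf
  have hs : Function.Surjective (f ≫ quotMk N hN).hom := (quotMk_surjective N hN).comp hf
  -- With N the image of R(G), the group H / N is a quotient of I(G), hence abelian and profinite,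
  -- so R(H) dies in it.
  obtain ⟨l, hl⟩ := exists_desc (toReflection_surjective G) (f ≫ quotMk N hN) fun x hx =>
    quotMk_eq_one N hN ⟨x, hx, rfl⟩
  rw [← hl] at hs
  have hls : Function.Surjective l.hom := Function.Surjective.of_comp hs
  have := totallyDisconnected_of_surjective l hls
  have h1 := hom_radical (isAbelian_of_surjective (isAbelian_incl _) l hls) (quotMk N hN) hy
  obtain ⟨x, hx, hxy⟩ := (quotMk_eq_one_iff _ _).mp h1
  exact ⟨x, hx, hxy⟩

/-- The supremum of two closed normal subgroups is closed. -/
lemma isClosed_sup {G : CompGrp.{u}} {M N : Subgroup G} [N.Normal] (hM : IsClosed (M : Set G))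
    (hN : IsClosed (N : Set G)) : IsClosed ((M ⊔ N : Subgroup G) : Set G) := by
  rw [Subgroup.mul_normal]
  exact (hM.isCompact.mul hN.isCompact).isClosed

/-- The quotient of `G` by the right-hand side is a quotient both of the abelianization and of G /
G₀, so it is abelian and totally disconnected and kills the radical. This avoids computing the
identity component of the abelianization. -/
lemma radical_eq (G : CompGrp.{u}) : radical G = closedDerived G ⊔ idComp G := by
  refine le_antisymm (fun x hx => ?_) (sup_le (fun x hx => ?_) fun x hx => ?_)
  · have hcl := isClosed_sup (isClosed_closedDerived G) (isClosed_idComp G)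
    obtain ⟨l, hl⟩ := exists_desc (quotMk_surjective _ (isClosed_closedDerived G))
      (quotMk _ hcl) fun x hx => quotMk_eq_one _ hcl
        (Subgroup.mem_sup_left ((quotMk_eq_one_iff _ _).mp hx))
    obtain ⟨m, hm⟩ := exists_desc (quotMk_surjective _ (isClosed_idComp G))
      (quotMk _ hcl) fun x hx => quotMk_eq_one _ hcl
        (Subgroup.mem_sup_right ((quotMk_eq_one_iff _ _).mp hx))
    have hs := quotMk_surjective _ hcl
    have hls : Function.Surjective l.hom := by
      rw [← hl] at hs
      exact Function.Surjective.of_comp hs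
    have hms : Function.Surjective m.hom := by
      rw [← hm] at hs
      exact Function.Surjective.of_comp hs
    have := totallyDisconnected_quot_idComp G
    have := totallyDisconnected_of_surjective m hms
    exact (quotMk_eq_one_iff _ _).mp
      (hom_radical (isAbelian_of_surjective (abObj G).property l hls) (quotMk _ hcl) hx)
  · exact hom_closedDerived (isAbelian_incl _) (toReflection G) x hx
  · exact hom_idComp (toReflection G) x hx

/-! ### Trivial and normal extensions -/

/-- The condition is the uniqueness half of the pullback property. The existence half is automatic,
since R(X) maps onto R(B). -/
lemma isTrivialExtension_iff {X B : CompGrp.{u}} {f : X ⟶ B} (hf : Function.Surjective f.hom) :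
    galoisStructure.{u}.IsTrivialExtension f ↔ ∀ x ∈ radical X, f.hom x = 1 → x = 1 := by
  have hiff : galoisStructure.{u}.IsTrivialExtension f ↔ IsPullback (toReflection X) f
      (incl.map (reflector.map f)) (toReflection B) :=
    ⟨fun h => h.2, fun h => ⟨(isRegularEpi_iff_surjective f).mpr hf, h⟩⟩
  refine hiff.trans ⟨fun h x hx hfx => ?_, fun h => ?_⟩
  · exact isPullback_ext h ((mem_radical.mp hx).trans (map_one _).symm)
      (hfx.trans (map_one _).symm)
  · refine isPullback_of_elementwise (reflectorAdj.unit.naturality f).symm (fun ξ b hb => ?_)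
      fun x hx hfx => h x hx hfx
    obtain ⟨x, rfl⟩ := toReflection_surjective X ξ
    -- A preimage x of ξ need not lie over b. The error is in R(B), so it can be corrected by an
    -- element of R(X) without changing ξ.
    have hr : (f.hom x)⁻¹ * b ∈ radical B := by
      rw [mem_radical, map_mul, map_inv, toReflection_naturality, hb, inv_mul_cancel]
    obtain ⟨y, hy, hyb⟩ := exists_mem_radical hf hr
    refine ⟨x * y, ?_, ?_⟩
    · rw [map_mul, mem_radical.mp hy, mul_one]
    · rw [map_mul, hyb, mul_inv_cancel_left]

/-- The kernel of a morphism, as an object. -/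
def kerObj {X B : CompGrp.{u}} (p : X ⟶ B) : CompGrp.{u} :=
  ofClosed p.hom.toMonoidHom.ker (isClosed_singleton.preimage p.hom.continuous_toFun)

/-- The inclusion of the kernel. -/
def kerIncl {X B : CompGrp.{u}} (p : X ⟶ B) : kerObj p ⟶ X :=
  ofHom (G := kerObj p) ⟨Subgroup.subtype _, continuous_subtype_val⟩

/-- Surjections with a central profinite kernel. -/
structure IsCentralProfinite {X B : CompGrp.{u}} (p : X ⟶ B) : Prop where
  surjective : Function.Surjective p.hom
  central : ∀ x y, p.hom x = 1 → x * y = y * x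
  totallyDisconnected : TotallyDisconnectedSpace (kerObj p)

namespace IsCentralProfinite

variable {X B : CompGrp.{u}} {p : X ⟶ B}

lemma isAbelian_kerObj (hp : IsCentralProfinite p) : isAbelian (kerObj p) := fun x y =>
  Subtype.ext (hp.central x.1 y.1 x.2)

/-- Two morphisms into a central extension with equal images in `B` agree on radicals. -/
lemma eq_on_radical (hp : IsCentralProfinite p) {Y : CompGrp.{u}} (a b : Y ⟶ X) (h : a ≫ p = b ≫ p) {y : Y}
    (hy : y ∈ radical Y) : a.hom y = b.hom y := by
  have hmem : ∀ y, (a.hom y)⁻¹ * b.hom y ∈ p.hom.toMonoidHom.ker := fun y => by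
    have : p.hom (a.hom y) = p.hom (b.hom y) := congrArg (fun l => Hom.hom l y) h
    rw [MonoidHom.mem_ker]
    exact (map_mul p.hom _ _).trans (by rw [map_inv, this, inv_mul_cancel])
  -- The difference of `a` and `b` is multiplicative because its values are central.
  let d : Y ⟶ kerObj p := ofHom (H := kerObj p)
    ⟨MonoidHom.mk' (fun y => ⟨(a.hom y)⁻¹ * b.hom y, hmem y⟩) (fun y z => Subtype.ext (by
      change (a.hom (y * z))⁻¹ * b.hom (y * z) =
        ((a.hom y)⁻¹ * b.hom y) * ((a.hom z)⁻¹ * b.hom z)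
      rw [hp.central _ _ (hmem y), map_mul, map_mul, mul_assoc _ (b.hom z),
        ← hp.central _ _ (hmem y)]
      group)),
      ((a.hom.continuous_toFun.inv).mul b.hom.continuous_toFun).subtype_mk _⟩
  have := hp.totallyDisconnected
  have hd := hom_radical hp.isAbelian_kerObj d hy
  exact inv_mul_eq_one.mp (congrArg Subtype.val hd)

end IsCentralProfinite

/-! ### The diagonal and the kernel inside the kernel pair -/

section KernelPair

variable {X B : CompGrp.{u}} (p : X ⟶ B)

/-- The diagonal of the kernel pair. -/
noncomputable def diagonal : X ⟶ pullback p p := pullback.lift (𝟙 X) (𝟙 X) rfl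

@[simp]
lemma fst_diagonal (x : X) : (pullback.fst p p).hom ((diagonal p).hom x) = x :=
  congrArg (fun l => Hom.hom l x) (pullback.lift_fst (f := p) (g := p) (𝟙 X) (𝟙 X) rfl)

@[simp]
lemma snd_diagonal (x : X) : (pullback.snd p p).hom ((diagonal p).hom x) = x :=
  congrArg (fun l => Hom.hom l x) (pullback.lift_snd (f := p) (g := p) (𝟙 X) (𝟙 X) rfl)

lemma kernelPair_ext {r s : (pullback p p : CompGrp.{u})}
    (h₁ : (pullback.fst p p).hom r = (pullback.fst p p).hom s)
    (h₂ : (pullback.snd p p).hom r = (pullback.snd p p).hom s) : r = s :=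
  isPullback_ext (IsPullback.of_hasPullback p p) h₁ h₂

lemma kernelPair_w (r : (pullback p p : CompGrp.{u})) :
    p.hom ((pullback.fst p p).hom r) = p.hom ((pullback.snd p p).hom r) :=
  congrArg (fun l => Hom.hom l r) (pullback.condition (f := p) (g := p))

lemma kerIncl_comp : (0 : kerObj p ⟶ X) ≫ p = kerIncl p ≫ p := by
  ext k
  exact (map_one p.hom).trans (k.2 : p.hom k.1 = 1).symm

/-- The inclusion `k ↦ (1, k)` of the kernel into the kernel pair. -/
noncomputable def kerToPair : kerObj p ⟶ pullback p p :=
  pullback.lift 0 (kerIncl p) (kerIncl_comp p)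

@[simp]
lemma fst_kerToPair (k : kerObj p) : (pullback.fst p p).hom ((kerToPair p).hom k) = 1 :=
  congrArg (fun l => Hom.hom l k) (pullback.lift_fst _ _ (kerIncl_comp p))

@[simp]
lemma snd_kerToPair (k : kerObj p) :
    (pullback.snd p p).hom ((kerToPair p).hom k) = (kerIncl p).hom k :=
  congrArg (fun l => Hom.hom l k) (pullback.lift_snd _ _ (kerIncl_comp p))

lemma kerIncl_injective : Function.Injective (kerIncl p).hom := Subtype.val_injective

lemma fst_kernelPair_surjective : Function.Surjective (pullback.fst p p).hom := fun x =>
  ⟨_, fst_diagonal p x⟩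

end KernelPair

-- Triviality of the first projection forces every (1, k) in the radical of the kernel pair to
-- vanish; commutators with the diagonal and the identity component of the kernel supply such
-- elements. Conversely, for a central profinite kernel the two projections agree on the radical by
-- `IsCentralProfinite.eq_on_radical`, so an element of it with first component 1 is trivial.
open scoped commutatorElement in
lemma isNormalExtension_iff {X B : CompGrp.{u}} (p : X ⟶ B) :
    galoisStructure.{u}.IsNormalExtension p ↔ IsCentralProfinite p := by
  constructor
  · rintro ⟨⟨hE, -⟩, htriv⟩
    have hp : Function.Surjective p.hom := (isRegularEpi_iff_surjective p).mp hE
    rw [isTrivialExtension_iff (fst_kernelPair_surjective p)] at htriv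
    refine ⟨hp, fun x y hx => ?_, totallyDisconnected_of_connectedComponent_one fun k hk => ?_⟩
    · let k : kerObj p := ⟨x, hx⟩
      have hk : (kerIncl p).hom k = x := rfl
      -- This commutator is [(1, x), (y, y)] = (1, [x, y]).
      have hc : ⁅(kerToPair p).hom k, (diagonal p).hom y⁆ ∈ radical (pullback p p) := by
        rw [radical_eq]
        exact Subgroup.mem_sup_left (Subgroup.le_topologicalClosure _
          (Subgroup.commutator_mem_commutator (Subgroup.mem_top _) (Subgroup.mem_top _)))
      have h1 := htriv _ hc (by rw [map_commutatorElement, fst_kerToPair,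
        commutatorElement_one_left])
      have h2 := congrArg (pullback.snd p p).hom h1
      rw [map_commutatorElement, snd_kerToPair, snd_diagonal, map_one, hk] at h2
      exact commutatorElement_eq_one_iff_mul_comm.mp h2
    · have hk' : k ∈ radical (kerObj p) := by
        rw [radical_eq]
        exact Subgroup.mem_sup_right hk
      have h1 := htriv _ (map_mem_radical (kerToPair p) hk') (fst_kerToPair p k)
      refine kerIncl_injective p ?_
      rw [← snd_kerToPair, h1, map_one, map_one]
  · intro hp
    refine ⟨isMonadicExtension_of_surjective hp.surjective,
      (isTrivialExtension_iff (fst_kernelPair_surjective p)).mpr fun r hr h1 => ?_⟩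
    refine kernelPair_ext p (h1.trans (map_one _).symm) ?_
    rw [← hp.eq_on_radical (pullback.fst p p) (pullback.snd p p) pullback.condition hr, h1, map_one]

/-! ### The Galois group of a normal extension -/

section GaloisGroup

variable {X B : CompGrp.{u}} (p : X ⟶ B)

/-- The intersection of the kernel of `p` with the radical. -/
def kerRadical : Subgroup X := p.hom.toMonoidHom.ker ⊓ radical X

lemma isClosed_kerRadical : IsClosed (kerRadical p : Set X) :=
  (isClosed_singleton.preimage p.hom.continuous_toFun).inter (isClosed_radical X)

lemma mem_kerRadical {x : X} : x ∈ kerRadical p ↔ p.hom x = 1 ∧ x ∈ radical X := Iff.rfl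

/-- `kerRadical p` as an object. -/
def kerRadicalObj : CompGrp.{u} := ofClosed (kerRadical p) (isClosed_kerRadical p)

/-- The inclusion into the kernel. -/
def kerRadicalToKer : kerRadicalObj p ⟶ kerObj p :=
  ofHom (G := kerRadicalObj p) (H := kerObj p)
    ⟨Subgroup.inclusion inf_le_left, continuous_inclusion inf_le_left⟩

variable {p}

/-- `kerRadical p` as an abelian profinite group. -/
def IsCentralProfinite.kerRadicalProf (hp : IsCentralProfinite p) : AbProf.{u} :=
  ⟨⟨kerRadicalObj p, fun x y => Subtype.ext (hp.central x.1 y.1 x.2.1)⟩,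
    totallyDisconnected_of_connectedComponent_one (H := kerRadicalObj p) fun n hn => by
      have := hp.totallyDisconnected
      have h := hom_idComp (kerRadicalToKer p) n hn
      exact Subtype.ext (congrArg (kerIncl p).hom h)⟩

/-- The comparison of `kerRadical p` with the reflection of the kernel pair. -/
noncomputable def IsCentralProfinite.toReflectionPair (hp : IsCentralProfinite p) :
    hp.kerRadicalProf ⟶ reflector.obj (pullback p p) :=
  incl.preimage (X := hp.kerRadicalProf)
    (kerRadicalToKer p ≫ kerToPair p ≫ toReflection (pullback p p))

lemma IsCentralProfinite.toReflectionPair_apply (hp : IsCentralProfinite p)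
    (n : incl.obj hp.kerRadicalProf) : Hom.hom (incl.map hp.toReflectionPair) n =
      (toReflection (pullback p p)).hom ((kerToPair p).hom ((kerRadicalToKer p).hom n)) := by
  have h : incl.map hp.toReflectionPair =
      kerRadicalToKer p ≫ kerToPair p ≫ toReflection (pullback p p) := incl.map_preimage _
  rw [h]
  rfl

lemma reflector_map_apply {G H : CompGrp.{u}} (f : G ⟶ H) (x : G) :
    Hom.hom (incl.map (reflector.map f)) ((toReflection G).hom x) = 1 ↔ f.hom x ∈ radical H := by
  rw [mem_radical, toReflection_naturality]

lemma incl_hom_ext {C C' : AbProf.{u}} {a b : C ⟶ C'}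
    (h : ∀ x, Hom.hom (incl.map a) x = Hom.hom (incl.map b) x) : a = b :=
  incl.map_injective (hom_ext h)

lemma incl_zero_apply {C C' : AbProf.{u}} (x : incl.obj C) :
    Hom.hom (incl.map (0 : C ⟶ C')) x = 1 := rfl

-- The map n ↦ class of (1, n) is injective because the first projection of the kernel pair is a
-- trivial extension. It hits the class of every (x, y) with x, y ∈ R(X): since (x, x) is in the
-- radical of the kernel pair, that class equals the class of (1, x⁻¹y).
open scoped ZeroObject in
lemma IsCentralProfinite.isPullback (hp : IsCentralProfinite p) :
    IsPullback hp.toReflectionPair (0 : hp.kerRadicalProf ⟶ 0)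
      (prod.lift (reflector.map (pullback.fst p p)) (reflector.map (pullback.snd p p)))
      (0 : (0 : AbProf.{u}) ⟶ reflector.obj X ⨯ reflector.obj X) := by
  have w : hp.toReflectionPair ≫
      prod.lift (reflector.map (pullback.fst p p)) (reflector.map (pullback.snd p p)) =
      (0 : hp.kerRadicalProf ⟶ 0) ≫ 0 := by
    rw [zero_comp]
    apply Limits.prod.hom_ext
    · rw [Category.assoc, prod.lift_fst, zero_comp]
      refine incl_hom_ext fun n => ?_
      rw [Functor.map_comp, comp_apply, hp.toReflectionPair_apply, incl_zero_apply,
        reflector_map_apply, fst_kerToPair]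
      exact one_mem _
    · rw [Category.assoc, prod.lift_snd, zero_comp]
      refine incl_hom_ext fun n => ?_
      rw [Functor.map_comp, comp_apply, hp.toReflectionPair_apply, incl_zero_apply,
        reflector_map_apply, snd_kerToPair]
      exact n.2.2
  -- The inclusion is fully faithful, so it reflects pullbacks and the check can be made on elements
  -- of compact groups.
  refine IsPullback.of_map incl w (isPullback_of_elementwise ?_ (fun r z h => ?_) fun n hn _ => ?_)
  · rw [← Functor.map_comp, w, Functor.map_comp]
  · obtain ⟨t, rfl⟩ := toReflection_surjective _ r
    rw [incl_zero_apply] at h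
    have h₁ : (pullback.fst p p).hom t ∈ radical X := by
      have := congrArg (Hom.hom (incl.map prod.fst)) h
      rw [← comp_apply, ← Functor.map_comp, prod.lift_fst, map_one] at this
      exact (reflector_map_apply _ _).mp this
    have h₂ : (pullback.snd p p).hom t ∈ radical X := by
      have := congrArg (Hom.hom (incl.map prod.snd)) h
      rw [← comp_apply, ← Functor.map_comp, prod.lift_snd, map_one] at this
      exact (reflector_map_apply _ _).mp this
    have hn : ((pullback.fst p p).hom t)⁻¹ * (pullback.snd p p).hom t ∈ kerRadical p := by
      rw [mem_kerRadical]
      refine ⟨?_, mul_mem (inv_mem h₁) h₂⟩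
      rw [map_mul, map_inv, kernelPair_w, inv_mul_cancel]
    let n : incl.obj hp.kerRadicalProf := (⟨_, hn⟩ : kerRadicalObj p)
    refine ⟨n, ?_, ?_⟩
    · have ht : (kerToPair p).hom ((kerRadicalToKer p).hom n) =
          ((diagonal p).hom ((pullback.fst p p).hom t))⁻¹ * t := by
        refine kernelPair_ext p ?_ ?_
        · rw [fst_kerToPair, map_mul, map_inv, fst_diagonal, inv_mul_cancel]
        · rw [snd_kerToPair, map_mul, map_inv, snd_diagonal]
          rfl
      rw [hp.toReflectionPair_apply, ht, map_mul, map_inv,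
        mem_radical.mp (map_mem_radical (diagonal p) h₁), inv_one, one_mul]
    · have hz : z = 1 := (congrArg (fun l => Hom.hom (incl.map l) z)
        ((isZero_zero AbProf.{u}).eq_of_src (𝟙 _) 0)).trans (incl_zero_apply z)
      rw [hz]
      rfl
  · rw [hp.toReflectionPair_apply] at hn
    have htriv := ((isNormalExtension_iff p).mpr hp).2
    rw [isTrivialExtension_iff (fst_kernelPair_surjective p)] at htriv
    have h1 := htriv _ (mem_radical.mpr hn) (fst_kerToPair p _)
    have h2 := congrArg (pullback.snd p p).hom h1
    rw [snd_kerToPair, map_one] at h2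
    exact Subtype.ext h2

/-- Isomorphic compact groups are isomorphic topological groups. -/
def continuousMulEquivOfIso {G H : CompGrp.{u}} (e : G ≅ H) : G ≃ₜ* H where
  toFun := e.hom.hom
  invFun := e.inv.hom
  left_inv x := congrArg (fun l => Hom.hom l x) e.hom_inv_id
  right_inv x := congrArg (fun l => Hom.hom l x) e.inv_hom_id
  map_mul' := map_mul e.hom.hom
  continuous_toFun := e.hom.hom.continuous_toFun
  continuous_invFun := e.inv.hom.continuous_toFun

lemma IsCentralProfinite.nonempty_galoisGroup_iso (hp : IsCentralProfinite p) :
    Nonempty (incl.obj (galoisStructure.{u}.galoisGroup p) ≅ kerRadicalObj p) :=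
  ⟨(incl.mapIso hp.isPullback.isoPullback).symm⟩

end GaloisGroup

/-- A morphism over `B` maps `kerRadical` to `kerRadical`. -/
def kerRadicalMap {X Y B : CompGrp.{u}} {p : X ⟶ B} {q : Y ⟶ B} (u : X ⟶ Y) (hu : u ≫ q = p) :
    kerRadicalObj p ⟶ kerRadicalObj q :=
  ofHom (G := kerRadicalObj p) (H := kerRadicalObj q)
    ⟨(u.hom.toMonoidHom.comp (kerRadical p).subtype).codRestrict (kerRadical q) fun n =>
      ⟨(congrArg (fun l => Hom.hom l n.1) hu).trans n.2.1, map_mem_radical u n.2.2⟩,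
      (u.hom.continuous_toFun.comp continuous_subtype_val).subtype_mk _⟩

/-- `kerRadical` is the same for any two normal extensions of `B` that map to each other. -/
def kerRadicalIso {X Y B : CompGrp.{u}} {p : X ⟶ B} {q : Y ⟶ B} (hp : IsCentralProfinite p)
    (hq : IsCentralProfinite q) (u : X ⟶ Y) (hu : u ≫ q = p) (v : Y ⟶ X) (hv : v ≫ p = q) :
    kerRadicalObj p ≅ kerRadicalObj q where
  hom := kerRadicalMap u hu
  inv := kerRadicalMap v hv
  hom_inv_id := by
    ext n
    exact Subtype.ext (hp.eq_on_radical (u ≫ v) (𝟙 X)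
      (by rw [Category.assoc, hv, hu, Category.id_comp]) n.2.2)
  inv_hom_id := by
    ext n
    exact Subtype.ext (hq.eq_on_radical (v ≫ u) (𝟙 Y)
      (by rw [Category.assoc, hu, hv, Category.id_comp]) n.2.2)

/-! ### The weakly universal normal extension of a projective presentation -/

section Presentation

variable {P B : CompGrp.{u}} (f : P ⟶ B)

/-- The kernel of `f`. -/
abbrev ker : Subgroup P := f.hom.toMonoidHom.ker

lemma isClosed_ker : IsClosed (ker f : Set P) :=
  isClosed_singleton.preimage f.hom.continuous_toFun

lemma isClosed_idCompOf : IsClosed (idCompOf (ker f) : Set P) :=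
  ((isClosed_idComp (kerObj f)).isCompact.image continuous_subtype_val).isClosed

lemma isClosed_hopfDen : IsClosed (hopfDen (ker f) : Set P) :=
  isClosed_sup (Subgroup.isClosed_topologicalClosure _) (isClosed_idCompOf f)

/-- Morphisms over `B` to central profinite extensions kill `hopfDen`. -/
lemma hom_hopfDen {X : CompGrp.{u}} {p : X ⟶ B} (hp : IsCentralProfinite p) (l : P ⟶ X)
    (hl : l ≫ p = f) : ∀ x ∈ hopfDen (ker f), l.hom x = 1 := by
  have hlp : ∀ x, p.hom (l.hom x) = f.hom x := fun x => congrArg (fun l => Hom.hom l x) hl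
  suffices h : hopfDen (ker f) ≤ ker l from fun x hx => h hx
  refine sup_le (Subgroup.topologicalClosure_minimal _ ?_ (isClosed_ker l)) ?_
  · refine Subgroup.commutator_le.mpr fun a ha b _ => ?_
    rw [MonoidHom.mem_ker, map_commutatorElement, commutatorElement_eq_one_iff_mul_comm]
    exact hp.central _ _ ((hlp a).trans ha)
  · rintro _ ⟨k, hk, rfl⟩
    -- Since `l` lies over `B`, it restricts to a map from K to the totally disconnected kernel of
    -- `p`, which kills K₀.
    let m : kerObj f ⟶ kerObj p := ofHom (G := kerObj f) (H := kerObj p)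
      ⟨(l.hom.toMonoidHom.comp (ker f).subtype).codRestrict (ker p) fun n =>
        (hlp n.1).trans n.2, (l.hom.continuous_toFun.comp continuous_subtype_val).subtype_mk _⟩
    have := hp.totallyDisconnected
    exact congrArg (kerIncl p).hom (hom_idComp m k hk)

lemma hopfDen_le_ker : hopfDen (ker f) ≤ ker f := by
  refine sup_le (Subgroup.topologicalClosure_minimal _ (Subgroup.commutator_le_left _ _)
    (isClosed_ker f)) ?_
  rintro _ ⟨k, -, rfl⟩
  exact k.2

/-- The quotient of `P` by `cl[K, P] · K₀`. -/
abbrev hopfExtObj : CompGrp.{u} := quot (hopfDen (ker f)) (isClosed_hopfDen f)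

/-- The projection from `P`. -/
abbrev hopfExtMk : P ⟶ hopfExtObj f := quotMk (hopfDen (ker f)) (isClosed_hopfDen f)

/-- The extension of `B` induced by `f` on the quotient of `P` by `cl[K, P] · K₀`. -/
def hopfExt : hopfExtObj f ⟶ B :=
  quotLift (hopfDen (ker f)) (isClosed_hopfDen f) f fun _ hx => hopfDen_le_ker f hx

lemma hopfExt_mk (x : P) : (hopfExt f).hom ((hopfExtMk f).hom x) = f.hom x := rfl

lemma hopfExtMk_surjective : Function.Surjective (hopfExtMk f).hom := quotMk_surjective _ _

lemma hopfExtMk_eq_one {x : P} : (hopfExtMk f).hom x = 1 ↔ x ∈ hopfDen (ker f) :=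
  quotMk_eq_one_iff _ _

variable {f}

-- Dividing by cl[K, P] makes the kernel central. Dividing by K₀ makes it a quotient of the
-- profinite group K / K₀, hence totally disconnected.
open scoped commutatorElement in
lemma isCentralProfinite_hopfExt (hf : Function.Surjective f.hom) :
    IsCentralProfinite (hopfExt f) := by
  refine ⟨fun b => ?_, fun x y hx => ?_, ?_⟩
  · obtain ⟨x, rfl⟩ := hf b
    exact ⟨_, hopfExt_mk f x⟩
  · obtain ⟨a, rfl⟩ := hopfExtMk_surjective f x
    obtain ⟨b, rfl⟩ := hopfExtMk_surjective f y
    rw [← commutatorElement_eq_one_iff_mul_comm, ← map_commutatorElement, hopfExtMk_eq_one]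
    exact Subgroup.mem_sup_left (Subgroup.le_topologicalClosure _
      (Subgroup.commutator_mem_commutator hx (Subgroup.mem_top b)))
  · let m : kerObj f ⟶ kerObj (hopfExt f) := ofHom (G := kerObj f) (H := kerObj (hopfExt f))
      ⟨((hopfExtMk f).hom.toMonoidHom.comp (ker f).subtype).codRestrict (ker (hopfExt f))
        fun n => n.2,
        ((hopfExtMk f).hom.continuous_toFun.comp continuous_subtype_val).subtype_mk _⟩
    have hm : Function.Surjective m.hom := by
      rintro ⟨x, hx⟩
      obtain ⟨a, rfl⟩ := hopfExtMk_surjective f x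
      exact ⟨⟨a, hx⟩, rfl⟩
    obtain ⟨l, hl⟩ := exists_desc (quotMk_surjective _ (isClosed_idComp (kerObj f))) m
      fun k hk => Subtype.ext ((hopfExtMk_eq_one f).mpr
        (Subgroup.mem_sup_right ⟨k, (quotMk_eq_one_iff _ _).mp hk, rfl⟩))
    rw [← hl] at hm
    have := totallyDisconnected_quot_idComp (kerObj f)
    exact totallyDisconnected_of_surjective l (Function.Surjective.of_comp hm)

/-- Projectivity lifts `f` through any normal extension, and by `hom_hopfDen` the lift descends to
the quotient of `P`. -/
lemma isWeaklyUniversal_hopfExt (hf : Function.Surjective f.hom)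
    (hP : IsProjectiveWrt (MorphismProperty.regularEpi CompGrp.{u}) P) :
    galoisStructure.{u}.IsWeaklyUniversalNormalExtension (hopfExt f) := by
  refine ⟨(isNormalExtension_iff _).mpr (isCentralProfinite_hopfExt hf), fun X' p' hp' => ?_⟩
  obtain ⟨l, hl⟩ := hP p' f hp'.1.1
  refine ⟨quotLift _ (isClosed_hopfDen f) l
    (hom_hopfDen f ((isNormalExtension_iff p').mp hp') l hl), ?_⟩
  have := epi_of_surjective (hopfExtMk_surjective f)
  rw [← cancel_epi (hopfExtMk f)]
  exact hl

/-- The right-hand side of the Hopf formula is the radical part of the kernel of `hopfExt f`. -/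
lemma nonempty_hopfQuotient_equiv (f : P ⟶ B) :
    Nonempty (kerRadicalObj (hopfExt f) ≃ₜ* HopfQuotient (ker f)) := by
  have hnum : hopfNum (ker f) = ker f ⊓ radical P := by rw [radical_eq]; rfl
  have hcl : IsClosed (hopfNum (ker f) : Set P) := by
    rw [hnum]
    exact (isClosed_ker f).inter (isClosed_radical P)
  let N : CompGrp.{u} := ofClosed (hopfNum (ker f)) hcl
  let D : Subgroup N := (hopfDen (ker f)).subgroupOf (hopfNum (ker f))
  have hDn : D.Normal := inferInstanceAs ((hopfDen (ker f)).subgroupOf (hopfNum (ker f))).Normal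
  have hD : IsClosed (D : Set N) := (isClosed_hopfDen f).preimage continuous_subtype_val
  let m : N ⟶ kerRadicalObj (hopfExt f) := ofHom (G := N) (H := kerRadicalObj (hopfExt f))
    ⟨((hopfExtMk f).hom.toMonoidHom.comp (hopfNum (ker f)).subtype).codRestrict
      (kerRadical (hopfExt f)) fun n =>
        ⟨n.2.1, map_mem_radical (hopfExtMk f) (hnum ▸ n.2 : n.1 ∈ ker f ⊓ radical P).2⟩,
      ((hopfExtMk f).hom.continuous_toFun.comp continuous_subtype_val).subtype_mk _⟩
  have hm1 : ∀ n : N, m.hom n = 1 ↔ n ∈ D := fun n =>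
    Subtype.ext_iff.trans (hopfExtMk_eq_one f)
  -- A radical element of the quotient lifts to R(P); the lift is automatically in K, because
  -- `hopfExt f` composed with the projection is `f`.
  have hm : Function.Surjective m.hom := by
    rintro ⟨x, hx, hr⟩
    obtain ⟨a, ha, rfl⟩ := exists_mem_radical (hopfExtMk_surjective f) hr
    exact ⟨⟨a, hnum ▸ (⟨hx, ha⟩ : a ∈ ker f ⊓ radical P)⟩, rfl⟩
  let l : quot D hD ⟶ kerRadicalObj (hopfExt f) := quotLift D hD m fun x hx => (hm1 x).mpr hx
  have hl : Function.Bijective l.hom := by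
    refine ⟨(injective_iff_map_eq_one l.hom).mpr fun x hx => ?_, fun y => ?_⟩
    · obtain ⟨n, rfl⟩ := quotMk_surjective D hD x
      exact quotMk_eq_one D hD ((hm1 n).mp hx)
    · obtain ⟨n, rfl⟩ := hm y
      exact ⟨(quotMk D hD).hom n, rfl⟩
  have := isIso_of_bijective hl
  exact ⟨continuousMulEquivOfIso (asIso l).symm⟩

end Presentation

end CompGrp

/-- For the reflection of compact Hausdorff groups onto abelian profinite groups: given a projective
presentation `f : P ⟶ B` with kernel `K`, the fundamental group of `B` (the Galois group of any
weakly universal normal extension of `B`, and such an extension exists) is isomorphic, as a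
topological group, to `(K ∧ (cl[P, P] · P₀)) / (cl[K, P] · K₀)`. -/
theorem mainTheorem8 {P B : CompGrp.{u}} (f : P ⟶ B) (hf : IsRegularEpi f)
    (hP : IsProjectiveWrt (MorphismProperty.regularEpi CompGrp.{u}) P) :
    (∃ (X : CompGrp.{u}) (p : X ⟶ B),
      CompGrp.galoisStructure.{u}.IsWeaklyUniversalNormalExtension p) ∧
    ∀ (X : CompGrp.{u}) (p : X ⟶ B),
      CompGrp.galoisStructure.{u}.IsWeaklyUniversalNormalExtension p →
        Nonempty ((CompGrp.incl.obj (CompGrp.galoisStructure.{u}.galoisGroup p)) ≃ₜ*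
          CompGrp.HopfQuotient f.hom.toMonoidHom.ker) := by
  have hs := (CompGrp.isRegularEpi_iff_surjective f).mp hf
  have huniv := CompGrp.isWeaklyUniversal_hopfExt hs hP
  have hq := CompGrp.isCentralProfinite_hopfExt hs
  refine ⟨⟨_, _, huniv⟩, fun X p hpu => ?_⟩
  have hp := (CompGrp.isNormalExtension_iff p).mp hpu.1
  -- Weak universality on both sides gives maps over `B` in both directions. They need not be
  -- inverse to each other, but they become so on kernel ∩ radical.
  obtain ⟨u, hu⟩ := hpu.2 _ huniv.1
  obtain ⟨v, hv⟩ := huniv.2 _ hpu.1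
  obtain ⟨e⟩ := hp.nonempty_galoisGroup_iso
  obtain ⟨e'⟩ := CompGrp.nonempty_hopfQuotient_equiv f
  exact ⟨(CompGrp.continuousMulEquivOfIso
    (e ≪≫ CompGrp.kerRadicalIso hp hq u hu v hv)).trans e'⟩
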